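/- Let $(X,\rho,|\cdot|)$ be a homogeneous space: $\rho\ge 0$ is a quasimetric on $X$ ($\rho(x,y)=0$ iff $x=y$, $\rho$ is symmetric, $\rho(x,z)\le C_0(\rho(x,y)+\rho(y,z))$), the balls $B(x,r)=\{y:\rho(x,y)<r\}$ are measurable, and the measure $|\cdot|$ is doubling: $0<|B(x,2r)|\le C_d|B(x,r)|<\infty$ for all $x\in X$, $r>0$. A dyadic decomposition of $X$ with constants $C>0$, $0<\delta<1$, $0<\epsilon<1$ is a family $S=\bigcup_{m\in\mathbb Z}S_m$ of measurable sets with points $x_c(Q)$ such that: $|X\setminus\bigcup_{Q\in S_m}Q|=0$ for every $m$; any two elements of $S$ are disjoint or nested; every $Q\in S_m$ contains at least one element of $S_{m+1}$ (a child of $Q$) and is contained in exactly one element of $S_{m-1}$; a child $Q_2$ of $Q_1$ satisfies $|Q_2|\ge\epsilon|Q_1|$; and $B(x_c(Q),\delta^m)\subset Q\subset B(x_c(Q),C\delta^m)$ for $Q\in S_m$. An element $Q$ of $S$ is understood together with its level $k(Q)$, where $Q\in S_{k(Q)}$. For $Q_0\in S$, a sparse family in $Q_0$ is $S(Q_0)=\bigcup_{n\ge0}C_n$,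 where $C_0=\{Q_0\}$, each $C_n$ consists of pairwise disjoint elements of $S$ contained in $Q_0$, each $Q\in C_{n+1}$ is contained in an element of $C_n$, and $\big|\bigcup_{Q\in C_{n+1}}Q\cap Q_1\big|\le|Q_1|/2$ for every $Q_1\in C_n$. Let $D>0$. Then there is a constant $\beta$, depending only on the space $X$ and the constants $C,\delta,\epsilon,D$, such that the following holds. Let $S$ be a dyadic decomposition of $X$ with constants $C,\delta,\epsilon$, let $Q_0\in S$, let $S(Q_0)$ be a sparse family in $Q_0$, let $k\ge1$ be an integer, and let $S^j$ be any dyadic decomposition of $X$ (possibly with other constants). Let $S'(Q_0)\subset S(Q_0)$ be a subfamily such that to each $Q\in S'(Q_0)$ there is assigned a set $Q^*\in S^j$ with $$B\big(x_c(Q),2^kC\delta^{k(Q)}\big)\subset Q^*,\qquad \operatorname{diam}(Q^*)\le D\,2^kC\delta^{k(Q)} .$$ Let $$B^*f=\sum_{Q\in S'(Q_0)}\frac1{|Q^*|}\Big(\int_Q f\Big)\chi_{Q^*}$$ be the formal adjoint of the discrete operator $B_{j,k}f=\sum_{Q\in S'(Q_0)}\frac1{|Q^*|}\Big(\int_{Q^*}f\Big)\chi_Q$.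 Then for every $f\in L^1(X)$ the series defining $B^*f$ converges absolutely almost everywhere, and $$\|B^*f\|_{1,\infty}=\sup_{a>0}\,a\,\big|\{x:|B^*f(x)|>a\}\big|\le\beta\,k\,\|f\|_1 .$$ -/

import Mathlib

open MeasureTheory
open scoped ENNReal NNReal

noncomputable section

/-- The open ball `B(x, r)` of a quasimetric `ρ`. -/
def qball {X : Type*} (ρ : X → X → ℝ) (x : X) (r : ℝ) : Set X :=
  {y | ρ x y < r}

/-- The diameter of a set with respect to `ρ`, as an extended nonnegative number. -/
def qdiam {X : Type*} (ρ : X → X → ℝ) (A : Set X) : ℝ≥0∞ :=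
  ⨆ x ∈ A, ⨆ y ∈ A, ENNReal.ofReal (ρ x y)

/-- `(X, ρ, μ)` is a homogeneous space: `ρ` is a quasimetric with quasitriangle constant `C₀`,
balls are measurable, and `μ` is doubling with constant `Cd`. -/
structure IsHomogeneousSpace {X : Type*} [MeasurableSpace X] (ρ : X → X → ℝ) (μ : Measure X)
    (C₀ Cd : ℝ) : Prop where
  C₀_pos : 0 < C₀
  Cd_pos : 0 < Cd
  nonneg : ∀ x y, 0 ≤ ρ x y
  eq_zero_iff : ∀ x y, ρ x y = 0 ↔ x = y
  symm : ∀ x y, ρ x y = ρ y x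
  quasitriangle : ∀ x y z, ρ x z ≤ C₀ * (ρ x y + ρ y z)
  measurableSet_ball : ∀ (x : X) (r : ℝ), MeasurableSet (qball ρ x r)
  ball_pos : ∀ (x : X) (r : ℝ), 0 < r → 0 < μ (qball ρ x r)
  ball_lt_top : ∀ (x : X) (r : ℝ), 0 < r → μ (qball ρ x r) < ∞
  doubling : ∀ (x : X) (r : ℝ), 0 < r →
    μ (qball ρ x (2 * r)) ≤ ENNReal.ofReal Cd * μ (qball ρ x r)

/-- A dyadic decomposition `S = ⋃ₖ Sₖ` with constants `C`, `δ`, `ε`. The generation `Sₖ` is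
`cubes k`, and `center k Q` is the point `x_c(Q)` attached to `Q ∈ Sₖ`. (The same subset of `X`
may belong to several generations, for instance when `X` has isolated points or is bounded;
this is why the centre is attached to a set together with its generation.) -/
structure DyadicDecomposition {X : Type*} [MeasurableSpace X] (ρ : X → X → ℝ) (μ : Measure X)
    (C δ ε : ℝ) where
  cubes : ℤ → Set (Set X)
  center : ℤ → Set X → X
  C_pos : 0 < C
  δ_pos : 0 < δ
  δ_lt_one : δ < 1
  ε_pos : 0 < ε
  ε_lt_one : ε < 1
  measurableSet_cube : ∀ k, ∀ Q ∈ cubes k, MeasurableSet Q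
  ae_cover : ∀ k, μ (⋃₀ cubes k)ᶜ = 0
  disjoint_or_subset : ∀ k l, ∀ Q₁ ∈ cubes k, ∀ Q₂ ∈ cubes l,
    Disjoint Q₁ Q₂ ∨ Q₁ ⊆ Q₂ ∨ Q₂ ⊆ Q₁
  exists_child : ∀ k, ∀ Q₁ ∈ cubes k, ∃ Q₂ ∈ cubes (k + 1), Q₂ ⊆ Q₁
  existsUnique_parent : ∀ k, ∀ Q₁ ∈ cubes k, ∃! Q₃, Q₃ ∈ cubes (k - 1) ∧ Q₁ ⊆ Q₃
  child_measure : ∀ k, ∀ Q₁ ∈ cubes k, ∀ Q₂ ∈ cubes (k + 1), Q₂ ⊆ Q₁ →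
    ENNReal.ofReal ε * μ Q₁ ≤ μ Q₂
  ball_subset : ∀ k, ∀ Q ∈ cubes k, qball ρ (center k Q) (δ ^ k) ⊆ Q
  subset_ball : ∀ k, ∀ Q ∈ cubes k, Q ⊆ qball ρ (center k Q) (C * δ ^ k)

namespace DyadicDecomposition

/-- An element of a dyadic decomposition: a set `Q ∈ Sₖ` together with its level `k = k(Q)`. -/
structure Cube {X : Type*} [MeasurableSpace X] {ρ : X → X → ℝ} {μ : Measure X} {C δ ε : ℝ}
    (S : DyadicDecomposition ρ μ C δ ε) where
  level : ℤ
  carrier : Set X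
  mem : carrier ∈ S.cubes level

/-- The dilated set `t Q = B(x_c(Q), t C δ ^ k(Q))`. -/
def Cube.dilate {X : Type*} [MeasurableSpace X] {ρ : X → X → ℝ} {μ : Measure X} {C δ ε : ℝ}
    {S : DyadicDecomposition ρ μ C δ ε} (Q : S.Cube) (t : ℝ) : Set X :=
  qball ρ (S.center Q.level Q.carrier) (t * C * δ ^ Q.level)

end DyadicDecomposition

/-- The families `F 0, F 1, …` of elements of `S` form a sparse family in `Q₀`; the sparse family
itself is `S(Q₀) = ⋃ₙ F n`. -/
structure IsSparseFamily {X : Type*} [MeasurableSpace X] {ρ : X → X → ℝ} {μ : Measure X}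
    {C δ ε : ℝ} (S : DyadicDecomposition ρ μ C δ ε) (Q₀ : S.Cube) (F : ℕ → Set S.Cube) :
    Prop where
  zero : F 0 = {Q₀}
  subset_top : ∀ n, ∀ Q ∈ F n, Q.carrier ⊆ Q₀.carrier
  disjoint : ∀ n, ∀ Q ∈ F n, ∀ Q' ∈ F n, Q ≠ Q' → Disjoint Q.carrier Q'.carrier
  nested : ∀ n, ∀ Q ∈ F (n + 1), ∃ Q' ∈ F n, Q.carrier ⊆ Q'.carrier
  half : ∀ n, ∀ Q₁ ∈ F n, μ (⋃ Q ∈ F (n + 1), Q.carrier ∩ Q₁.carrier) ≤ μ Q₁.carrier / 2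

/-- `star` assigns to each `Q` in the family `S'` an element `Q* = star Q` of the dyadic
decomposition `T` with `2 ^ k Q ⊆ Q*` and `diam Q* ≤ D 2 ^ k C δ ^ k(Q)`. -/
def IsStarMap {X : Type*} [MeasurableSpace X] {ρ : X → X → ℝ} {μ : Measure X}
    {C δ ε C' δ' ε' : ℝ} {S : DyadicDecomposition ρ μ C δ ε}
    {T : DyadicDecomposition ρ μ C' δ' ε'} (D : ℝ) (k : ℕ) (S' : Set S.Cube)
    (star : S' → T.Cube) : Prop :=
  ∀ Q : S', (Q : S.Cube).dilate (2 ^ k) ⊆ (star Q).carrier ∧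
    qdiam ρ (star Q).carrier ≤ ENNReal.ofReal (D * 2 ^ k * C * δ ^ (Q : S.Cube).level)

/-- The discrete operator `B f = ∑_{Q ∈ S'} (1 / |Q*|) (∫_{Q*} f) χ_Q`. -/
def discreteOp {X : Type*} [MeasurableSpace X] {ρ : X → X → ℝ} {μ : Measure X}
    {C δ ε C' δ' ε' : ℝ} {S : DyadicDecomposition ρ μ C δ ε}
    {T : DyadicDecomposition ρ μ C' δ' ε'} {S' : Set S.Cube} (star : S' → T.Cube)
    (f : X → ℝ) (x : X) : ℝ :=
  ∑' Q : S', (Q : S.Cube).carrier.indicator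
    (fun _ => 1 / μ.real (star Q).carrier * ∫ y in (star Q).carrier, f y ∂μ) x

/-- The summand `(1 / |Q*|) (∫_Q f) χ_{Q*}` of the formal adjoint of the discrete operator. -/
def discreteAdjointTerm {X : Type*} [MeasurableSpace X] {ρ : X → X → ℝ} {μ : Measure X}
    {C δ ε C' δ' ε' : ℝ} {S : DyadicDecomposition ρ μ C δ ε}
    {T : DyadicDecomposition ρ μ C' δ' ε'} {S' : Set S.Cube} (star : S' → T.Cube)
    (f : X → ℝ) (Q : S') (x : X) : ℝ :=
  (star Q).carrier.indicator
    (fun _ => 1 / μ.real (star Q).carrier * ∫ y in (Q : S.Cube).carrier, f y ∂μ) x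

/-- The formal adjoint `B* f = ∑_{Q ∈ S'} (1 / |Q*|) (∫_Q f) χ_{Q*}` of the discrete operator. -/
def discreteAdjoint {X : Type*} [MeasurableSpace X] {ρ : X → X → ℝ} {μ : Measure X}
    {C δ ε C' δ' ε' : ℝ} {S : DyadicDecomposition ρ μ C δ ε}
    {T : DyadicDecomposition ρ μ C' δ' ε'} {S' : Set S.Cube} (star : S' → T.Cube)
    (f : X → ℝ) (x : X) : ℝ :=
  ∑' Q : S', discreteAdjointTerm star f Q x

/-- The weak `L¹` quasinorm `‖g‖_{1,∞} = sup_{a > 0} a |{x : |g x| > a}|`. -/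
def weakL1Norm {X : Type*} [MeasurableSpace X] (μ : Measure X) (g : X → ℝ) : ℝ≥0∞ :=
  ⨆ a : ℝ≥0, (a : ℝ≥0∞) * μ {x | (a : ℝ) < |g x|}

end

/-! Replace `f` by `φ = |f|` and work with finitely many cubes at height `a`. Let `u` be the maximal
cubes on which the average of `φ` exceeds `a`; they are disjoint and of total measure at most `‖f‖₁
/ a`. The cubes split into three kinds.

Cubes in no member of `u` have averages at most `a`. If `A` is the set where their sum exceeds `a`,
integrating over `A` bounds `a |A|` by the sum of `|Q|` times the average of `φ` on `Q` times the
average of `χ_A` on `Q*`. Sparseness replaces `|Q|` by `2 |E_Q|` with disjoint `E_Q ⊆ Q`. Each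
factor obeys an `L²` Carleson bound, since averages over nested sets are of weak type (1,1) with
constant 1 and are bounded here. The arithmetic-geometric inequality leaves a multiple of `‖f‖₁`
plus `a |A| / 2`, which is absorbed. Of the second dyadic system only nestedness and `0 < |Q*| < ∞`
matter, so its constants do not enter.

Cubes `Q ⊆ P ∈ u` with `2^k δ^k(Q) ≤ δ^k(P)` have `Q*` in a fixed dilate of `P`; by doubling these
dilates form a small exceptional set. The remaining `Q ⊆ P` occupy at most `L k` levels, each
consisting of disjoint cubes, so their sum has `L¹` norm at most `L k ‖f‖₁`. This is the only place
where `k` enters. -/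

/-! ### Nested families and the weak type (1,1) bound -/

/-- A finite family of sets that are pairwise disjoint or nested has a pairwise disjoint subfamily
whose members contain all the others. -/
theorem exists_pairwiseDisjoint_subfamily {X ι : Type*} (s : Finset ι) (Q : ι → Set X)
    (hn : ∀ i ∈ s, ∀ j ∈ s, Disjoint (Q i) (Q j) ∨ Q i ⊆ Q j ∨ Q j ⊆ Q i) :
    ∃ u ⊆ s, (u : Set ι).PairwiseDisjoint Q ∧ ∀ i ∈ s, ∃ j ∈ u, Q i ⊆ Q j := by
  classical
  induction s using Finset.induction_on with
  | empty => exact ⟨∅, by simp⟩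
  | insert i s _ ih =>
    obtain ⟨u, hus, hd, hc⟩ := ih fun p hp q hq =>
      hn p (Finset.mem_insert_of_mem hp) q (Finset.mem_insert_of_mem hq)
    by_cases hi : ∃ j ∈ u, Q i ⊆ Q j
    · refine ⟨u, hus.trans (Finset.subset_insert _ _), hd, fun p hp => ?_⟩
      rcases Finset.mem_insert.1 hp with rfl | hp
      · exact hi
      · exact hc p hp
    -- Members of `u` that meet `Q i` lie inside it, so they can be dropped.
    · refine ⟨insert i (u.filter fun j => Disjoint (Q i) (Q j)), ?_, ?_, ?_⟩
      · exact Finset.insert_subset_insert _ ((Finset.filter_subset _ _).trans hus)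
      · rw [Finset.coe_insert]
        refine Set.PairwiseDisjoint.insert (hd.subset ?_) ?_
        · exact_mod_cast Finset.filter_subset _ u
        · intro j hj _
          exact (Finset.mem_filter.1 (Finset.mem_coe.1 hj)).2
      · intro p hp
        rcases Finset.mem_insert.1 hp with rfl | hp
        · exact ⟨p, Finset.mem_insert_self _ _, subset_rfl⟩
        · obtain ⟨j, hj, hpj⟩ := hc p hp
          rcases hn i (Finset.mem_insert_self _ _) j (Finset.mem_insert_of_mem (hus hj))
            with h | h | h
          · exact ⟨j, Finset.mem_insert_of_mem (Finset.mem_filter.2 ⟨hj, h⟩), hpj⟩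
          · exact absurd ⟨j, hj, h⟩ hi
          · exact ⟨i, Finset.mem_insert_self _ _, hpj.trans h⟩

/-- The weak type `(1, 1)` inequality for a finite family of sets that are pairwise disjoint or
nested. -/
theorem mul_measure_biUnion_le_of_nested {X ι : Type*} [MeasurableSpace X] {μ : Measure X}
    (s : Finset ι) (Q : ι → Set X) (hm : ∀ i ∈ s, MeasurableSet (Q i))
    (hn : ∀ i ∈ s, ∀ j ∈ s, Disjoint (Q i) (Q j) ∨ Q i ⊆ Q j ∨ Q j ⊆ Q i)
    (φ : X → ℝ≥0∞) (t : ℝ≥0∞) (h : ∀ i ∈ s, t * μ (Q i) ≤ ∫⁻ x in Q i, φ x ∂μ) :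
    t * μ (⋃ i ∈ s, Q i) ≤ ∫⁻ x, φ x ∂μ := by
  obtain ⟨u, hus, hd, hc⟩ := exists_pairwiseDisjoint_subfamily s Q hn
  have hsub : (⋃ i ∈ s, Q i) ⊆ ⋃ i ∈ u, Q i := by
    refine Set.iUnion₂_subset fun i hi => ?_
    obtain ⟨j, hj, hij⟩ := hc i hi
    exact hij.trans (Set.subset_biUnion_of_mem (u := Q) hj)
  calc t * μ (⋃ i ∈ s, Q i) ≤ t * ∑ i ∈ u, μ (Q i) := by
        gcongr
        exact (measure_mono hsub).trans (measure_biUnion_finset_le _ _)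
    _ = ∑ i ∈ u, t * μ (Q i) := Finset.mul_sum _ _ _
    _ ≤ ∑ i ∈ u, ∫⁻ x in Q i, φ x ∂μ := Finset.sum_le_sum fun i hi => h i (hus hi)
    _ = ∫⁻ x in ⋃ i ∈ u, Q i, φ x ∂μ :=
        (lintegral_biUnion_finset hd (fun i hi => hm i (hus hi)) φ).symm
    _ ≤ ∫⁻ x, φ x ∂μ := setLIntegral_le_lintegral _ _

/-! ### From weak type to Carleson bounds in `L²` -/

/-- A bounded function with a weak `L¹` bound is in `L²`. -/
theorem lintegral_sq_le_of_weak_bound {Ω : Type*} [MeasurableSpace Ω] (ν : Measure Ω)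
    (v : Ω → ℝ≥0) (hv : Measurable v) (b : ℝ≥0) (hb : ∀ᵐ x ∂ν, v x ≤ b) (M : ℝ≥0∞)
    (h : ∀ t : ℝ≥0, t * ν {x | t < v x} ≤ M) :
    ∫⁻ x, (v x : ℝ≥0∞) ^ 2 ∂ν ≤ 2 * b * M := by
  -- Layer cake: the integral of `2 t ν{v > t}` runs only over `0 < t ≤ b`, where the integrand is
  -- at most `2 M`.
  have key := lintegral_rpow_eq_lintegral_meas_lt_mul ν (f := fun x => (v x : ℝ))
    (Filter.Eventually.of_forall fun x => (v x).coe_nonneg)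
    hv.coe_nnreal_real.aemeasurable (p := 2) (by norm_num)
  have h1 : ∀ x, ENNReal.ofReal ((v x : ℝ) ^ (2 : ℝ)) = (v x : ℝ≥0∞) ^ 2 := fun x => by
    rw [Real.rpow_two, ENNReal.ofReal_pow (v x).coe_nonneg, ENNReal.ofReal_coe_nnreal]
  simp_rw [h1] at key
  rw [key, mul_assoc]
  have h2 : ENNReal.ofReal 2 = 2 := by simp
  rw [h2]
  gcongr
  calc ∫⁻ t in Set.Ioi (0 : ℝ), ν {x | t < v x} * ENNReal.ofReal (t ^ ((2 : ℝ) - 1))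
      ≤ ∫⁻ t in Set.Ioi (0 : ℝ), (Set.Ioc (0 : ℝ) b).indicator (fun _ => M) t := by
        refine setLIntegral_mono' measurableSet_Ioi fun t (ht : 0 < t) => ?_
        by_cases htb : t ≤ b
        · rw [Set.indicator_of_mem (show t ∈ Set.Ioc (0 : ℝ) b from ⟨ht, htb⟩)]
          have := h ⟨t, ht.le⟩
          have e : ((2 : ℝ) - 1) = 1 := by norm_num
          rw [e, Real.rpow_one, mul_comm]
          rw [ENNReal.ofReal_eq_coe_nnreal ht.le]
          exact this
        · have : ν {x | t < v x} = 0 := by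
            refine measure_mono_null (fun x hx => ?_) (ae_iff.1 hb)
            simp only [Set.mem_ofPred_eq, not_le] at hx htb ⊢
            exact_mod_cast htb.trans hx
          simp [this]
    _ ≤ ∫⁻ t, (Set.Ioc (0 : ℝ) b).indicator (fun _ => M) t := setLIntegral_le_lintegral _ _
    _ = b * M := by
        rw [lintegral_indicator measurableSet_Ioc]
        simp [mul_comm]

/-- The discrete form of `lintegral_sq_le_of_weak_bound`. -/
theorem sum_sq_mul_le_of_weak_bound {ι : Type*} (s : Finset ι) (v : ι → ℝ≥0) (w : ι → ℝ≥0∞)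
    (b : ℝ≥0) (hb : ∀ i ∈ s, v i ≤ b) (M : ℝ≥0∞)
    (h : ∀ t : ℝ≥0, t * ∑ i ∈ s with t < v i, w i ≤ M) :
    ∑ i ∈ s, (v i : ℝ≥0∞) ^ 2 * w i ≤ 2 * b * M := by
  classical
  let _ : MeasurableSpace ι := ⊤
  let ν : Measure ι := ∑ i ∈ s, w i • Measure.dirac i
  have hν : ∀ A : Set ι, ν A = ∑ i ∈ s with i ∈ A, w i := fun A => by
    simp [ν, Measure.finsetSum_apply, Finset.sum_filter, Set.indicator_apply]
  have key := lintegral_sq_le_of_weak_bound ν v measurable_from_top b ?_ M ?_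
  · refine le_trans (le_of_eq ?_) key
    simp [ν, mul_comm]
  · rw [ae_iff, hν, Finset.sum_eq_zero]
    intro i hi
    simp only [Finset.mem_filter, Set.mem_ofPred_eq] at hi
    exact absurd (hb i hi.1) hi.2
  · intro t
    rw [hν]
    exact h t

/-- A Carleson-type estimate: the `L²` bound for averages of `φ` over nested sets, summed against
disjoint subsets. -/
theorem sum_sq_average_le {X ι : Type*} [MeasurableSpace X] {μ : Measure X}
    (s : Finset ι) (Q E : ι → Set X) (hm : ∀ i ∈ s, MeasurableSet (Q i))
    (hn : ∀ i ∈ s, ∀ j ∈ s, Disjoint (Q i) (Q j) ∨ Q i ⊆ Q j ∨ Q j ⊆ Q i)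
    (hE : ∀ i ∈ s, MeasurableSet (E i)) (hEd : (s : Set ι).PairwiseDisjoint E)
    (hEQ : ∀ i ∈ s, E i ⊆ Q i) (φ : X → ℝ≥0∞) (v : ι → ℝ≥0) (b : ℝ≥0)
    (hb : ∀ i ∈ s, v i ≤ b) (h : ∀ i ∈ s, v i * μ (Q i) ≤ ∫⁻ x in Q i, φ x ∂μ) :
    ∑ i ∈ s, (v i : ℝ≥0∞) ^ 2 * μ (E i) ≤ 2 * b * ∫⁻ x, φ x ∂μ := by
  refine sum_sq_mul_le_of_weak_bound s v _ b hb _ fun t => ?_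
  have hmem : ∀ i ∈ s.filter (fun i => t < v i), i ∈ s := fun i hi => (Finset.mem_filter.1 hi).1
  rw [← measure_biUnion_finset (hEd.subset fun i hi => hmem i hi) fun i hi => hE i (hmem i hi)]
  refine le_trans ?_ (mul_measure_biUnion_le_of_nested (μ := μ) (s.filter fun i => t < v i) Q
    (fun i hi => hm i (hmem i hi)) (fun i hi j hj => hn i (hmem i hi) j (hmem j hj)) φ t
    fun i hi => le_trans ?_ (h i (hmem i hi)))
  · gcongr with i hi
    exact hEQ i (hmem i hi)
  · gcongr
    exact (Finset.mem_filter.1 hi).2.le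

/-! ### Cubes with small averages -/

/-- The weak type estimate for the adjoint sparse operator over the sets on which the average of
`φ` does not exceed the height `a`. -/
theorem mul_measure_lt_sum_le_of_average_le {X ι : Type*} [MeasurableSpace X] {μ : Measure X}
    (s : Finset ι) (Q R E : ι → Set X)
    (hQm : ∀ i ∈ s, MeasurableSet (Q i)) (hRm : ∀ i ∈ s, MeasurableSet (R i))
    (hQn : ∀ i ∈ s, ∀ j ∈ s, Disjoint (Q i) (Q j) ∨ Q i ⊆ Q j ∨ Q j ⊆ Q i)
    (hRn : ∀ i ∈ s, ∀ j ∈ s, Disjoint (R i) (R j) ∨ R i ⊆ R j ∨ R j ⊆ R i)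
    (hE : ∀ i ∈ s, MeasurableSet (E i)) (hEd : (s : Set ι).PairwiseDisjoint E)
    (hEQ : ∀ i ∈ s, E i ⊆ Q i) (hQR : ∀ i ∈ s, Q i ⊆ R i)
    (hQE : ∀ i ∈ s, μ (Q i) ≤ 2 * μ (E i))
    (hQ0 : ∀ i ∈ s, μ (Q i) ≠ 0) (hR : ∀ i ∈ s, μ (R i) ≠ ∞)
    (φ : X → ℝ≥0∞) (a : ℝ≥0) (ha : 0 < a) (hφ : ∀ i ∈ s, ∫⁻ x in Q i, φ x ∂μ ≤ a * μ (Q i)) :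
    a * μ {x | (a : ℝ≥0∞) < ∑ i ∈ s,
      (R i).indicator (fun _ => (∫⁻ y in Q i, φ y ∂μ) / μ (R i)) x} ≤ 16 * ∫⁻ x, φ x ∂μ := by
  set A : Set X := {x | (a : ℝ≥0∞) < ∑ i ∈ s,
      (R i).indicator (fun _ => (∫⁻ y in Q i, φ y ∂μ) / μ (R i)) x} with hA
  have hmeas : Measurable fun x => ∑ i ∈ s,
      (R i).indicator (fun _ => (∫⁻ y in Q i, φ y ∂μ) / μ (R i)) x :=
    Finset.measurable_sum _ fun i hi => measurable_const.indicator (hRm i hi)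
  have hAm : MeasurableSet A := measurableSet_lt measurable_const hmeas
  have hAR : A ⊆ ⋃ i ∈ s, R i := by
    intro x hx
    by_contra hxR
    simp only [Set.mem_iUnion, not_exists] at hxR
    have : (∑ i ∈ s, (R i).indicator (fun _ => (∫⁻ y in Q i, φ y ∂μ) / μ (R i)) x) = 0 :=
      Finset.sum_eq_zero fun i hi => Set.indicator_of_notMem (hxR i hi) _
    rw [hA, Set.mem_ofPred_eq, this] at hx
    exact not_lt_zero hx
  -- Finiteness permits the final absorption; this is why the sum is finite.
  have hAfin : μ A ≠ ∞ := by
    refine ne_top_of_le_ne_top ?_ ((measure_mono hAR).trans (measure_biUnion_finset_le _ _))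
    exact (ENNReal.sum_lt_top.2 fun i hi => (hR i hi).lt_top).ne
  have hQf : ∀ i ∈ s, μ (Q i) ≠ ∞ := fun i hi => measure_ne_top_of_subset (hQR i hi) (hR i hi)
  have hR0 : ∀ i ∈ s, μ (R i) ≠ 0 := fun i hi h0 => hQ0 i hi (measure_mono_null (hQR i hi) h0)
  let u : ι → ℝ≥0 := fun i => ((∫⁻ y in Q i, φ y ∂μ) / μ (Q i)).toNNReal
  let m : ι → ℝ≥0 := fun i => (μ (A ∩ R i) / μ (R i)).toNNReal
  have hudiv : ∀ i ∈ s, (∫⁻ y in Q i, φ y ∂μ) / μ (Q i) ≤ a := fun i hi =>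
    ENNReal.div_le_of_le_mul (hφ i hi)
  have hmdiv : ∀ i ∈ s, μ (A ∩ R i) / μ (R i) ≤ 1 := fun i hi =>
    ENNReal.div_le_of_le_mul (by rw [one_mul]; exact measure_mono Set.inter_subset_right)
  have hu : ∀ i ∈ s, (u i : ℝ≥0∞) = (∫⁻ y in Q i, φ y ∂μ) / μ (Q i) := fun i hi =>
    ENNReal.coe_toNNReal (ne_top_of_le_ne_top ENNReal.coe_ne_top (hudiv i hi))
  have hm : ∀ i ∈ s, (m i : ℝ≥0∞) = μ (A ∩ R i) / μ (R i) := fun i hi =>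
    ENNReal.coe_toNNReal (ne_top_of_le_ne_top ENNReal.one_ne_top (hmdiv i hi))
  have huQ : ∀ i ∈ s, (u i : ℝ≥0∞) * μ (Q i) = ∫⁻ y in Q i, φ y ∂μ := fun i hi => by
    rw [hu i hi, ENNReal.div_mul_cancel (hQ0 i hi) (hQf i hi)]
  have hmR : ∀ i ∈ s, (m i : ℝ≥0∞) * μ (R i) = ∫⁻ y in R i, A.indicator 1 y ∂μ := fun i hi => by
    rw [hm i hi, ENNReal.div_mul_cancel (hR0 i hi) (hR i hi), lintegral_indicator_one hAm,
      Measure.restrict_apply hAm]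
  have husq := sum_sq_average_le (μ := μ) s Q E hQm hQn hE hEd hEQ φ u a
    (fun i hi => by exact_mod_cast (hu i hi).trans_le (hudiv i hi)) fun i hi => (huQ i hi).le
  -- The same bound for averages of `χ_A` over the `R i`, which never exceed 1.
  have hmsq := sum_sq_average_le (μ := μ) s R E hRm hRn hE hEd
    (fun i hi => (hEQ i hi).trans (hQR i hi)) (A.indicator 1) m 1
    (fun i hi => by exact_mod_cast (hm i hi).trans_le (hmdiv i hi)) fun i hi => (hmR i hi).le
  rw [lintegral_indicator_one hAm] at hmsq
  -- The weights make the `A` term exactly `a / 4 * 2 * μ A = a * μ A / 2`.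
  have amgm : ∀ p q : ℝ≥0, (2 : ℝ≥0∞) * p * q ≤ 4 / a * p ^ 2 + a / 4 * q ^ 2 := fun p q => by
    have : 2 * p * q ≤ 4 / a * p ^ 2 + a / 4 * q ^ 2 := by
      rw [← NNReal.coe_le_coe]
      push_cast
      have ha' : (0 : ℝ) < a := ha
      have e : (4 / (a : ℝ) * p ^ 2 + a / 4 * q ^ 2) - 2 * p * q =
          (4 * p - a * q) ^ 2 / (4 * a) := by
        field_simp
        ring
      have : 0 ≤ (4 * (p : ℝ) - a * q) ^ 2 / (4 * a) := by positivity
      linarith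
    have h' := ENNReal.coe_le_coe.2 this
    rw [show ((4 : ℝ≥0∞) / a) = ((4 / a : ℝ≥0) : ℝ≥0∞) by
        rw [ENNReal.coe_div ha.ne']; simp,
      show ((a : ℝ≥0∞) / 4) = ((a / 4 : ℝ≥0) : ℝ≥0∞) by
        rw [ENNReal.coe_div (by norm_num)]; simp]
    exact_mod_cast h'
  have hint : a * μ A ≤ ∑ i ∈ s, (∫⁻ y in Q i, φ y ∂μ) * m i := by
    calc a * μ A = ∫⁻ _ in A, a ∂μ := (setLIntegral_const _ _).symm
      _ ≤ ∫⁻ x in A, ∑ i ∈ s,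
          (R i).indicator (fun _ => (∫⁻ y in Q i, φ y ∂μ) / μ (R i)) x ∂μ :=
          setLIntegral_mono hmeas fun x hx => le_of_lt hx
      _ = ∑ i ∈ s, ∫⁻ x in A,
          (R i).indicator (fun _ => (∫⁻ y in Q i, φ y ∂μ) / μ (R i)) x ∂μ :=
          lintegral_finsetSum' _ fun i hi =>
            (measurable_const.indicator (hRm i hi)).aemeasurable
      _ = ∑ i ∈ s, (∫⁻ y in Q i, φ y ∂μ) * m i := by
          refine Finset.sum_congr rfl fun i hi => ?_
          rw [lintegral_indicator_const (hRm i hi), Measure.restrict_apply (hRm i hi), hm i hi,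
            Set.inter_comm, ENNReal.mul_comm_div]
  have hsum : a * μ A ≤ 8 * (∫⁻ x, φ x ∂μ) + a * μ A / 2 := by
    calc a * μ A ≤ ∑ i ∈ s, (∫⁻ y in Q i, φ y ∂μ) * m i := hint
      _ ≤ ∑ i ∈ s, (4 / a * ((u i : ℝ≥0∞) ^ 2 * μ (E i)) +
          a / 4 * ((m i : ℝ≥0∞) ^ 2 * μ (E i))) := by
          refine Finset.sum_le_sum fun i hi => ?_
          calc (∫⁻ y in Q i, φ y ∂μ) * m i = u i * μ (Q i) * m i := by rw [huQ i hi]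
            _ ≤ u i * (2 * μ (E i)) * m i := by gcongr; exact hQE i hi
            _ = 2 * u i * m i * μ (E i) := by ring
            _ ≤ (4 / a * u i ^ 2 + a / 4 * m i ^ 2) * μ (E i) := by gcongr; exact amgm _ _
            _ = _ := by ring
      _ = 4 / a * ∑ i ∈ s, ((u i : ℝ≥0∞) ^ 2 * μ (E i)) +
          a / 4 * ∑ i ∈ s, ((m i : ℝ≥0∞) ^ 2 * μ (E i)) := by
          rw [Finset.sum_add_distrib, Finset.mul_sum, Finset.mul_sum]
      _ ≤ 4 / a * (2 * a * ∫⁻ x, φ x ∂μ) + a / 4 * (2 * (1 : ℝ≥0) * μ A) := by gcongr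
      _ = 8 * (∫⁻ x, φ x ∂μ) + a * μ A / 2 := by
          have ha0 : (a : ℝ≥0∞) ≠ 0 := by exact_mod_cast ha.ne'
          have e1 : (4 : ℝ≥0∞) / a * (2 * a) = 8 := by
            rw [mul_comm 2 (a : ℝ≥0∞), ← mul_assoc,
              ENNReal.div_mul_cancel ha0 ENNReal.coe_ne_top]
            norm_num
          have e2 : (4 : ℝ≥0∞)⁻¹ * 2 = 2⁻¹ := by
            rw [show (4 : ℝ≥0∞) = 2 * 2 by norm_num,
              ENNReal.mul_inv (by simp) (by simp), mul_assoc,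
              ENNReal.inv_mul_cancel (by simp) (by simp), mul_one]
          rw [← mul_assoc (4 / (a : ℝ≥0∞)), e1]
          congr 1
          rw [ENNReal.coe_one, mul_one, ENNReal.div_eq_inv_mul, ENNReal.div_eq_inv_mul,
            ← e2]
          ring
  have hfin : a * μ A / 2 ≠ ∞ :=
    (ENNReal.div_lt_top (ENNReal.mul_ne_top ENNReal.coe_ne_top hAfin) (by simp)).ne
  have hhalf : a * μ A / 2 ≤ 8 * ∫⁻ x, φ x ∂μ := by
    have h3 : a * μ A / 2 + a * μ A / 2 ≤ 8 * (∫⁻ x, φ x ∂μ) + a * μ A / 2 := by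
      rw [ENNReal.add_halves]
      exact hsum
    exact (ENNReal.add_le_add_iff_right hfin).1 h3
  calc a * μ A = a * μ A / 2 + a * μ A / 2 := (ENNReal.add_halves _).symm
    _ ≤ 8 * (∫⁻ x, φ x ∂μ) + 8 * ∫⁻ x, φ x ∂μ := add_le_add hhalf hhalf
    _ = 16 * ∫⁻ x, φ x ∂μ := by ring

/-! ### Balls, levels and dyadic cubes -/

namespace IsHomogeneousSpace

variable {X : Type*} [MeasurableSpace X] {ρ : X → X → ℝ} {μ : Measure X} {C₀ Cd : ℝ}

theorem measure_ball_pow_le (hX : IsHomogeneousSpace ρ μ C₀ Cd) (n : ℕ) (x : X) (r : ℝ)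
    (hr : 0 < r) : μ (qball ρ x (2 ^ n * r)) ≤ ENNReal.ofReal Cd ^ n * μ (qball ρ x r) := by
  induction n with
  | zero => simp
  | succ n ih =>
    calc μ (qball ρ x (2 ^ (n + 1) * r)) = μ (qball ρ x (2 * (2 ^ n * r))) := by
          rw [pow_succ]; congr 2; ring
      _ ≤ ENNReal.ofReal Cd * μ (qball ρ x (2 ^ n * r)) := hX.doubling _ _ (by positivity)
      _ ≤ ENNReal.ofReal Cd * (ENNReal.ofReal Cd ^ n * μ (qball ρ x r)) := by gcongr
      _ = _ := by ring

theorem mem_qball_self (hX : IsHomogeneousSpace ρ μ C₀ Cd) (x : X) {r : ℝ} (hr : 0 < r) :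
    x ∈ qball ρ x r := by
  change ρ x x < r
  rwa [(hX.eq_zero_iff x x).2 rfl]

end IsHomogeneousSpace

namespace DyadicDecomposition

variable {X : Type*} [MeasurableSpace X] {ρ : X → X → ℝ} {μ : Measure X} {C₀ Cd C δ ε : ℝ}
  (S : DyadicDecomposition ρ μ C δ ε)

/-- A child of `Q₁` has both sets as parents, and parents are unique. -/
theorem eq_of_subset {m : ℤ} {Q₁ Q₂ : Set X} (h₁ : Q₁ ∈ S.cubes m) (h₂ : Q₂ ∈ S.cubes m)
    (h : Q₁ ⊆ Q₂) : Q₁ = Q₂ := by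
  obtain ⟨R, hR, hRQ⟩ := S.exists_child m Q₁ h₁
  have e : m = m + 1 - 1 := by ring
  exact (S.existsUnique_parent (m + 1) R hR).unique ⟨e ▸ h₁, hRQ⟩ ⟨e ▸ h₂, hRQ.trans h⟩

theorem exists_ancestor {m : ℤ} {Q : Set X} (hQ : Q ∈ S.cubes m) (j : ℕ) :
    ∃ A ∈ S.cubes (m - j), Q ⊆ A := by
  induction j with
  | zero => exact ⟨Q, by simpa using hQ, subset_rfl⟩
  | succ j ih =>
    obtain ⟨A, hA, hQA⟩ := ih
    obtain ⟨A', ⟨hA', hAA'⟩, -⟩ := S.existsUnique_parent _ A hA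
    refine ⟨A', ?_, hQA.trans hAA'⟩
    rwa [show m - ((j + 1 : ℕ) : ℤ) = m - j - 1 by push_cast; ring]

namespace Cube

variable {S}

theorem ext_of_level {P Q : S.Cube} (hl : P.level = Q.level) (hc : P.carrier = Q.carrier) :
    P = Q := by
  cases P; cases Q
  simp_all

theorem measurableSet (Q : S.Cube) : MeasurableSet Q.carrier :=
  S.measurableSet_cube _ _ Q.mem

theorem measure_ne_top (hX : IsHomogeneousSpace ρ μ C₀ Cd) (Q : S.Cube) : μ Q.carrier ≠ ∞ :=
  ((measure_mono (S.subset_ball _ _ Q.mem)).trans_lt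
    (hX.ball_lt_top _ _ (mul_pos S.C_pos (zpow_pos S.δ_pos _)))).ne

theorem measure_pos (hX : IsHomogeneousSpace ρ μ C₀ Cd) (Q : S.Cube) : 0 < μ Q.carrier :=
  (hX.ball_pos _ _ (zpow_pos S.δ_pos _)).trans_le (measure_mono (S.ball_subset _ _ Q.mem))

theorem center_mem (hX : IsHomogeneousSpace ρ μ C₀ Cd) (Q : S.Cube) :
    S.center Q.level Q.carrier ∈ Q.carrier :=
  S.ball_subset _ _ Q.mem (hX.mem_qball_self _ (zpow_pos S.δ_pos _))

theorem not_disjoint_of_subset (hX : IsHomogeneousSpace ρ μ C₀ Cd) {P Q : S.Cube}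
    (h : Q.carrier ⊆ P.carrier) : ¬ Disjoint Q.carrier P.carrier := fun hd =>
  Set.disjoint_left.1 hd (Q.center_mem hX) (h (Q.center_mem hX))

theorem disjoint_or_subset (P Q : S.Cube) :
    Disjoint P.carrier Q.carrier ∨ P.carrier ⊆ Q.carrier ∨ Q.carrier ⊆ P.carrier :=
  S.disjoint_or_subset _ _ _ P.mem _ Q.mem

theorem disjoint_of_level_eq {P Q : S.Cube} (hl : P.level = Q.level) (hne : P ≠ Q) :
    Disjoint P.carrier Q.carrier := by
  rcases P.disjoint_or_subset Q with h | h | h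
  · exact h
  · exact absurd (ext_of_level hl (S.eq_of_subset P.mem (hl ▸ Q.mem) h)) hne
  · exact absurd (ext_of_level hl (S.eq_of_subset Q.mem (hl ▸ P.mem) h).symm) hne

/-- The ancestor of `P` at the level of `Q` contains `Q`, hence equals it. -/
theorem carrier_eq_of_level_lt {P Q : S.Cube} (h : Q.carrier ⊆ P.carrier)
    (hl : Q.level < P.level) : Q.carrier = P.carrier := by
  obtain ⟨A, hA, hPA⟩ := S.exists_ancestor P.mem (P.level - Q.level).toNat
  rw [show P.level - ((P.level - Q.level).toNat : ℤ) = Q.level by omega] at hA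
  exact h.antisymm (S.eq_of_subset Q.mem hA (h.trans hPA) ▸ hPA)

end Cube

end DyadicDecomposition

/-! ### Combinatorics of sparse families -/

namespace IsSparseFamily

variable {X : Type*} [MeasurableSpace X] {ρ : X → X → ℝ} {μ : Measure X} {C₀ Cd C δ ε : ℝ}
  {S : DyadicDecomposition ρ μ C δ ε} {Q₀ : S.Cube} {F : ℕ → Set S.Cube}

theorem exists_superset (hF : IsSparseFamily S Q₀ F) {n m : ℕ} (hnm : n ≤ m) {Q : S.Cube}
    (hQ : Q ∈ F m) : ∃ P ∈ F n, Q.carrier ⊆ P.carrier := by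
  induction m, hnm using Nat.le_induction generalizing Q with
  | base => exact ⟨Q, hQ, subset_rfl⟩
  | succ m _ ih =>
    obtain ⟨P, hP, hQP⟩ := hF.nested m Q hQ
    obtain ⟨R, hR, hPR⟩ := ih hP
    exact ⟨R, hR, hQP.trans hPR⟩

theorem countable (hX : IsHomogeneousSpace ρ μ C₀ Cd) (hF : IsSparseFamily S Q₀ F) (n : ℕ) :
    (F n).Countable := by
  have h := Measure.countable_meas_pos_of_disjoint_of_meas_iUnion_ne_top μ
    (As := fun Q : F n => (Q : S.Cube).carrier) (fun Q => (Q : S.Cube).measurableSet)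
    (fun P Q hPQ => hF.disjoint n P P.2 Q Q.2 fun h => hPQ (Subtype.ext h))
    (ne_top_of_le_ne_top (Q₀.measure_ne_top hX)
      (measure_mono (Set.iUnion_subset fun Q => hF.subset_top n Q Q.2)))
  have e : {Q : F n | 0 < μ (Q : S.Cube).carrier} = Set.univ :=
    Set.eq_univ_of_forall fun Q => (Q : S.Cube).measure_pos hX
  rw [e, Set.countable_univ_iff] at h
  exact Set.countable_coe_iff.1 h

theorem not_superset (hX : IsHomogeneousSpace ρ μ C₀ Cd) (hF : IsSparseFamily S Q₀ F) {n : ℕ}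
    {P Q : S.Cube} (hQ : Q ∈ F n) (hP : P ∈ F (n + 1)) : ¬ Q.carrier ⊆ P.carrier := fun h => by
  have h1 : μ Q.carrier ≤ μ Q.carrier / 2 := by
    refine le_trans (measure_mono fun x hx => ?_) (hF.half n Q hQ)
    exact Set.mem_biUnion hP ⟨h hx, hx⟩
  exact absurd h1 (not_le.2 (ENNReal.half_lt_self (Q.measure_pos hX).ne' (Q.measure_ne_top hX)))

/-- One set may belong to several levels of `S`; the halving condition prevents it from occurring
twice in a sparse family. -/
theorem eq_of_carrier_eq (hX : IsHomogeneousSpace ρ μ C₀ Cd) (hF : IsSparseFamily S Q₀ F)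
    {P Q : S.Cube} (hP : P ∈ ⋃ n, F n) (hQ : Q ∈ ⋃ n, F n) (h : P.carrier = Q.carrier) :
    P = Q := by
  obtain ⟨n, hP⟩ := Set.mem_iUnion.1 hP
  obtain ⟨m, hQ⟩ := Set.mem_iUnion.1 hQ
  rcases lt_trichotomy n m with hnm | rfl | hnm
  · obtain ⟨R, hR, hQR⟩ := hF.exists_superset (Nat.succ_le_of_lt hnm) hQ
    exact absurd (h.subset.trans hQR) (hF.not_superset hX hP hR)
  · by_contra hne
    exact DyadicDecomposition.Cube.not_disjoint_of_subset hX h.subset (hF.disjoint n P hP Q hQ hne)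
  · obtain ⟨R, hR, hPR⟩ := hF.exists_superset (Nat.succ_le_of_lt hnm) hP
    exact absurd (h.symm.subset.trans hPR) (hF.not_superset hX hQ hR)

theorem level_le_of_subset (hX : IsHomogeneousSpace ρ μ C₀ Cd) (hF : IsSparseFamily S Q₀ F)
    {P Q : S.Cube} (hP : P ∈ ⋃ n, F n) (hQ : Q ∈ ⋃ n, F n) (h : Q.carrier ⊆ P.carrier) :
    P.level ≤ Q.level := by
  by_contra hl
  push Not at hl
  have := hF.eq_of_carrier_eq hX hQ hP (DyadicDecomposition.Cube.carrier_eq_of_level_lt h hl)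
  rw [this] at hl
  exact lt_irrefl _ hl

/-- The elements of a sparse family contain pairwise disjoint subsets of comparable measure. -/
theorem exists_disjoint_subsets (hX : IsHomogeneousSpace ρ μ C₀ Cd)
    (hF : IsSparseFamily S Q₀ F) :
    ∃ E : S.Cube → Set X, (∀ Q ∈ ⋃ n, F n, MeasurableSet (E Q) ∧ E Q ⊆ Q.carrier ∧
      μ Q.carrier ≤ 2 * μ (E Q)) ∧ (⋃ n, F n).PairwiseDisjoint E := by
  classical
  let N : S.Cube → ℕ := fun Q => if h : ∃ n, Q ∈ F n then h.choose else 0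
  have hN : ∀ Q ∈ ⋃ n, F n, Q ∈ F (N Q) := fun Q hQ => by
    have h := Set.mem_iUnion.1 hQ
    simp only [N, dif_pos h]
    exact h.choose_spec
  let U : ℕ → Set X := fun n => ⋃ P ∈ F n, P.carrier
  have hU : ∀ n, MeasurableSet (U n) := fun n =>
    MeasurableSet.biUnion (hF.countable hX n) fun P _ => P.measurableSet
  -- A cube of a later generation lies in `U (N P + 1)`, which is removed from `P`.
  have hlt : ∀ P Q : S.Cube, Q ∈ F (N Q) → N P < N Q →
      Disjoint (P.carrier \ U (N P + 1)) (Q.carrier \ U (N Q + 1)) := fun P Q hQ h => by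
    obtain ⟨R, hR, hQR⟩ := hF.exists_superset (Nat.succ_le_of_lt h) hQ
    exact Set.disjoint_left.2 fun x hx hx' => hx.2 (Set.mem_biUnion hR (hQR hx'.1))
  refine ⟨fun Q => Q.carrier \ U (N Q + 1), fun Q hQ => ⟨Q.measurableSet.diff (hU _),
    Set.sdiff_subset, ?_⟩, fun P hP Q hQ hne => ?_⟩
  · have h1 : μ (Q.carrier ∩ U (N Q + 1)) ≤ μ Q.carrier / 2 := by
      refine le_trans (measure_mono fun x hx => ?_) (hF.half (N Q) Q (hN Q hQ))
      obtain ⟨P, hP, hxP⟩ := Set.mem_iUnion₂.1 hx.2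
      exact Set.mem_biUnion hP ⟨hxP, hx.1⟩
    have h2 := measure_inter_add_sdiff (μ := μ) Q.carrier (hU (N Q + 1))
    have h3 : μ Q.carrier / 2 ≤ μ (Q.carrier \ U (N Q + 1)) := by
      have hfin : μ Q.carrier / 2 ≠ ∞ := (ENNReal.div_lt_top (Q.measure_ne_top hX) (by simp)).ne
      refine (ENNReal.add_le_add_iff_left hfin).1 ?_
      rw [ENNReal.add_halves]
      calc μ Q.carrier = _ := h2.symm
        _ ≤ _ := by gcongr
    calc μ Q.carrier = 2 * (μ Q.carrier / 2) := (ENNReal.mul_div_cancel (by simp) (by simp)).symm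
      _ ≤ _ := by gcongr
  · rcases lt_trichotomy (N P) (N Q) with h | h | h
    · exact hlt P Q (hN Q hQ) h
    · exact (hF.disjoint (N P) P (hN P hP) Q (h ▸ hN Q hQ) hne).mono Set.sdiff_subset
        Set.sdiff_subset
    · exact (hlt Q P (hN P hP) h).symm

end IsSparseFamily

/-! ### Weak type estimate for nonnegative functions -/

namespace IsSparseFamily

variable {X : Type*} [MeasurableSpace X] {ρ : X → X → ℝ} {μ : Measure X}
  {C₀ Cd C δ ε C' δ' ε' D : ℝ}
  {S : DyadicDecomposition ρ μ C δ ε} {T : DyadicDecomposition ρ μ C' δ' ε'} {Q₀ : S.Cube}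
  {F : ℕ → Set S.Cube} {k : ℕ} {S' : Set S.Cube} {star : S' → T.Cube}

theorem _root_.IsStarMap.subset_star (hstar : IsStarMap D k S' star) (Q : S') :
    (Q : S.Cube).carrier ⊆ (star Q).carrier := by
  refine Set.Subset.trans (fun y hy => ?_) (hstar Q).1
  have h : ρ _ y < C * δ ^ (Q : S.Cube).level := S.subset_ball _ _ (Q : S.Cube).mem hy
  refine lt_of_lt_of_le h ?_
  rw [mul_assoc]
  exact le_mul_of_one_le_left (mul_pos S.C_pos (zpow_pos S.δ_pos _)).le
    (one_le_pow₀ (by norm_num))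

/-- If `2 ^ k ℓ(Q) ≤ ℓ(P)` and `Q ⊆ P`, then `Q*` lies in a fixed dilate of `P`. -/
theorem _root_.IsStarMap.star_subset_ball (hX : IsHomogeneousSpace ρ μ C₀ Cd) (hD : 0 < D)
    (hstar : IsStarMap D k S' star) {n : ℕ} (hn : C₀ * (C * (1 + D)) ≤ 2 ^ n) {Q : S'}
    {P : S.Cube} (hQP : (Q : S.Cube).carrier ⊆ P.carrier)
    (hl : 2 ^ k * δ ^ (Q : S.Cube).level ≤ δ ^ P.level) :
    (star Q).carrier ⊆ qball ρ (S.center P.level P.carrier) (2 ^ n * δ ^ P.level) := by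
  intro y hy
  -- The centre of `Q` lies in both `P` and `Q*`, so one quasitriangle inequality suffices.
  set x := S.center (Q : S.Cube).level (Q : S.Cube).carrier with hx
  have hxQ : x ∈ (Q : S.Cube).carrier := (Q : S.Cube).center_mem hX
  have hC := S.C_pos
  have hδ := zpow_pos S.δ_pos P.level
  have hδ' := zpow_pos S.δ_pos (Q : S.Cube).level
  have h1 : ρ (S.center P.level P.carrier) x < C * δ ^ P.level :=
    S.subset_ball _ _ P.mem (hQP hxQ)
  have h2 : ρ x y ≤ D * 2 ^ k * C * δ ^ (Q : S.Cube).level := by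
    refine (ENNReal.ofReal_le_ofReal_iff (by positivity)).1 (le_trans ?_ (hstar Q).2)
    exact le_iSup₂_of_le x (hstar.subset_star Q hxQ) (le_iSup₂_of_le y hy le_rfl)
  have h3 : D * 2 ^ k * C * δ ^ (Q : S.Cube).level ≤ D * C * δ ^ P.level := by
    calc D * 2 ^ k * C * δ ^ (Q : S.Cube).level
        = D * C * (2 ^ k * δ ^ (Q : S.Cube).level) := by ring
      _ ≤ D * C * δ ^ P.level := by gcongr
  change ρ _ y < _
  calc ρ (S.center P.level P.carrier) y
      ≤ C₀ * (ρ (S.center P.level P.carrier) x + ρ x y) := hX.quasitriangle _ _ _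
    _ < C₀ * (C * δ ^ P.level + D * C * δ ^ P.level) :=
        mul_lt_mul_of_pos_left (by linarith) hX.C₀_pos
    _ = C₀ * (C * (1 + D)) * δ ^ P.level := by ring
    _ ≤ 2 ^ n * δ ^ P.level := by gcongr

/-- Only `L k` generations of cubes `Q ⊆ P` are not local with respect to `P`, and the cubes of
each generation are disjoint. -/
theorem sum_nonlocal_le (hX : IsHomogeneousSpace ρ μ C₀ Cd) (hF : IsSparseFamily S Q₀ F)
    (hS' : S' ⊆ ⋃ n, F n) {L : ℕ} (hL : δ ^ L ≤ 1 / 2) {P : S.Cube} (hP : P ∈ S')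
    (s : Finset S') (hs : ∀ Q ∈ s, (Q : S.Cube).carrier ⊆ P.carrier ∧
      δ ^ P.level < 2 ^ k * δ ^ (Q : S.Cube).level) (φ : X → ℝ≥0∞) :
    ∑ Q ∈ s, ∫⁻ x in (Q : S.Cube).carrier, φ x ∂μ ≤
      (L * k : ℕ) * ∫⁻ x in P.carrier, φ x ∂μ := by
  classical
  have hlev : ∀ Q ∈ s, (Q : S.Cube).level ∈ Finset.Ico P.level (P.level + (L * k : ℕ)) := by
    intro Q hQ
    have h1 := hF.level_le_of_subset hX (hS' hP) (hS' Q.2) (hs Q hQ).1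
    refine Finset.mem_Ico.2 ⟨h1, ?_⟩
    by_contra hlt
    push Not at hlt
    have hδ := S.δ_pos
    have h2 : δ ^ (Q : S.Cube).level ≤ δ ^ (P.level + (L * k : ℕ)) :=
      zpow_le_zpow_right_of_le_one₀ hδ S.δ_lt_one.le hlt
    rw [zpow_add₀ hδ.ne', zpow_natCast, pow_mul] at h2
    -- Descending `L k` levels offsets the factor `2 ^ k`, making `Q` local.
    have h3 : (δ ^ L) ^ k ≤ (1 / 2) ^ k := pow_le_pow_left₀ (by positivity) hL k
    have h4 : 2 ^ k * δ ^ (Q : S.Cube).level ≤ δ ^ P.level := by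
      calc 2 ^ k * δ ^ (Q : S.Cube).level ≤ 2 ^ k * (δ ^ P.level * (1 / 2) ^ k) := by
            gcongr
            exact h2.trans (by gcongr)
        _ = δ ^ P.level * (2 * (1 / 2)) ^ k := by rw [mul_pow]; ring
        _ = δ ^ P.level := by norm_num
    exact absurd (hs Q hQ).2 (not_lt.2 h4)
  rw [← Finset.sum_fiberwise_of_maps_to hlev]
  calc _ ≤ ∑ _l ∈ Finset.Ico P.level (P.level + (L * k : ℕ)), ∫⁻ x in P.carrier, φ x ∂μ := by
        refine Finset.sum_le_sum fun l _ => ?_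
        rw [← lintegral_biUnion_finset (t := fun Q : S' => (Q : S.Cube).carrier) ?_
          fun Q _ => (Q : S.Cube).measurableSet]
        · exact lintegral_mono_set (Set.iUnion₂_subset fun Q hQ =>
            (hs Q (Finset.mem_filter.1 hQ).1).1)
        · intro Q hQ R hR hne
          have hQ := (Finset.mem_filter.1 (Finset.mem_coe.1 hQ)).2
          have hR := (Finset.mem_filter.1 (Finset.mem_coe.1 hR)).2
          exact DyadicDecomposition.Cube.disjoint_of_level_eq (hQ.trans hR.symm)
            fun h => hne (Subtype.ext h)
    _ = _ := by
        rw [Finset.sum_const, Int.card_Ico, add_sub_cancel_left, Int.toNat_natCast, nsmul_eq_mul]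

/-- The weak type estimate for finite subsums. -/
theorem mul_measure_lt_finset_sum_le (hX : IsHomogeneousSpace ρ μ C₀ Cd) (hD : 0 < D)
    (hF : IsSparseFamily S Q₀ F) (hS' : S' ⊆ ⋃ n, F n) (hstar : IsStarMap D k S' star)
    {n : ℕ} (hn : C₀ * (C * (1 + D)) ≤ 2 ^ n) {L : ℕ} (hL : δ ^ L ≤ 1 / 2)
    (s : Finset S') (φ : X → ℝ≥0∞) (a : ℝ≥0) (ha : 0 < a) :
    a * μ {x | 2 * (a : ℝ≥0∞) < ∑ Q ∈ s, (star Q).carrier.indicator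
      (fun _ => (∫⁻ y in (Q : S.Cube).carrier, φ y ∂μ) / μ (star Q).carrier) x} ≤
      (16 + ENNReal.ofReal Cd ^ n + (L * k : ℕ)) * ∫⁻ x, φ x ∂μ := by
  classical
  obtain ⟨E, hE, hEd⟩ := hF.exists_disjoint_subsets hX
  let c : S' → Set X := fun Q => (Q : S.Cube).carrier
  let g : S' → X → ℝ≥0∞ := fun Q => (star Q).carrier.indicator
      (fun _ => (∫⁻ y in c Q, φ y ∂μ) / μ (star Q).carrier)
  change a * μ {x | 2 * (a : ℝ≥0∞) < ∑ Q ∈ s, g Q x} ≤ _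
  obtain ⟨u, hus, hud, huc⟩ := exists_pairwiseDisjoint_subfamily
    (s.filter fun Q => a * μ (c Q) < ∫⁻ y in c Q, φ y ∂μ) c
    fun P _ Q _ => (P : S.Cube).disjoint_or_subset Q
  have hua : ∀ P ∈ u, a * μ (c P) ≤ ∫⁻ y in c P, φ y ∂μ := fun P hP =>
    (Finset.mem_filter.1 (hus hP)).2.le
  have husum : ∑ P ∈ u, ∫⁻ y in c P, φ y ∂μ ≤ ∫⁻ y, φ y ∂μ := by
    rw [← lintegral_biUnion_finset hud fun Q _ => (Q : S.Cube).measurableSet]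
    exact setLIntegral_le_lintegral _ _
  let s₂ : Finset S' := s.filter fun Q => ¬ ∃ P ∈ u, c Q ⊆ c P
  let t : S' → Finset S' := fun P => s.filter fun Q => c Q ⊆ c P ∧
    δ ^ (P : S.Cube).level < 2 ^ k * δ ^ (Q : S.Cube).level
  let sN : Finset S' := u.biUnion t
  let Ω : Set X := ⋃ P ∈ u, qball ρ (S.center (P : S.Cube).level (c P))
    (2 ^ n * δ ^ (P : S.Cube).level)
  -- Off `Ω` the local cubes contribute nothing; the other two sums share the height `2a`.
  have hsub : {x | 2 * (a : ℝ≥0∞) < ∑ Q ∈ s, g Q x} ⊆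
      {x | (a : ℝ≥0∞) < ∑ Q ∈ s₂, g Q x} ∪ Ω ∪ {x | (a : ℝ≥0∞) ≤ ∑ Q ∈ sN, g Q x} := by
    intro x hx
    by_contra hx'
    simp only [Set.mem_union, Set.mem_ofPred_eq, not_or, not_lt, not_le] at hx hx'
    obtain ⟨⟨h1, h2⟩, h3⟩ := hx'
    refine absurd hx (not_lt.2 ?_)
    have hsplit : ∑ Q ∈ s, g Q x ≤ ∑ Q ∈ s₂, g Q x + ∑ Q ∈ sN, g Q x := by
      rw [← Finset.sum_filter_add_sum_filter_not s (fun Q => ∃ P ∈ u, c Q ⊆ c P), add_comm]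
      refine add_le_add le_rfl ?_
      refine Finset.sum_le_sum_of_ne_zero fun Q hQ hQx => ?_
      obtain ⟨hQs, P, hP, hQP⟩ := Finset.mem_filter.1 hQ
      refine Finset.mem_biUnion.2 ⟨P, hP, Finset.mem_filter.2 ⟨hQs, hQP, ?_⟩⟩
      by_contra hl
      have hxQ : x ∈ (star Q).carrier := Set.mem_of_indicator_ne_zero hQx
      exact h2 (Set.mem_biUnion hP (hstar.star_subset_ball hX hD hn hQP (not_lt.1 hl) hxQ))
    calc _ ≤ _ := hsplit
      _ ≤ a + a := add_le_add h1 h3.le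
      _ = 2 * a := (two_mul _).symm
  have hs₂ : a * μ {x | (a : ℝ≥0∞) < ∑ Q ∈ s₂, g Q x} ≤ 16 * ∫⁻ x, φ x ∂μ := by
    refine mul_measure_lt_sum_le_of_average_le s₂ c (fun Q => (star Q).carrier)
      (fun Q => E Q) (fun Q _ => (Q : S.Cube).measurableSet) (fun Q _ => (star Q).measurableSet)
      (fun P _ Q _ => (P : S.Cube).disjoint_or_subset Q)
      (fun P _ Q _ => (star P).disjoint_or_subset (star Q))
      (fun Q _ => (hE Q (hS' Q.2)).1)
      (fun P _ Q _ hne => hEd (hS' P.2) (hS' Q.2) fun h => hne (Subtype.ext h))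
      (fun Q _ => (hE Q (hS' Q.2)).2.1) (fun Q _ => hstar.subset_star Q)
      (fun Q _ => (hE Q (hS' Q.2)).2.2) (fun Q _ => ((Q : S.Cube).measure_pos hX).ne')
      (fun Q _ => (star Q).measure_ne_top hX) φ a ha fun Q hQ => ?_
    obtain ⟨hQs, hQu⟩ := Finset.mem_filter.1 hQ
    by_contra hlt
    exact hQu (huc Q (Finset.mem_filter.2 ⟨hQs, not_le.1 hlt⟩))
  -- Doubling compares each dilate with the inner ball of `P`.
  have hΩ : a * μ Ω ≤ ENNReal.ofReal Cd ^ n * ∫⁻ x, φ x ∂μ := by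
    calc a * μ Ω ≤ a * ∑ P ∈ u, ENNReal.ofReal Cd ^ n * μ (c P) := by
          refine mul_le_mul_right ((measure_biUnion_finset_le _ _).trans
            (Finset.sum_le_sum fun P _ => ?_)) _
          refine (hX.measure_ball_pow_le n _ _ (zpow_pos S.δ_pos _)).trans ?_
          exact mul_le_mul_right (measure_mono (S.ball_subset _ _ (P : S.Cube).mem)) _
      _ = ENNReal.ofReal Cd ^ n * ∑ P ∈ u, a * μ (c P) := by
          rw [Finset.mul_sum, Finset.mul_sum]
          exact Finset.sum_congr rfl fun P _ => by ring
      _ ≤ ENNReal.ofReal Cd ^ n * ∑ P ∈ u, ∫⁻ y in c P, φ y ∂μ := by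
          gcongr with P hP
          exact hua P hP
      _ ≤ _ := by gcongr
  -- Markov's inequality; the term of `Q` has integral `∫_Q φ`.
  have hsN : a * μ {x | (a : ℝ≥0∞) ≤ ∑ Q ∈ sN, g Q x} ≤ (L * k : ℕ) * ∫⁻ x, φ x ∂μ := by
    have hgm : ∀ Q, Measurable (g Q) := fun Q => measurable_const.indicator (star Q).measurableSet
    calc _ ≤ ∫⁻ x, ∑ Q ∈ sN, g Q x ∂μ :=
          mul_meas_ge_le_lintegral (Finset.measurable_sum _ fun Q _ => hgm Q) _
      _ = ∑ Q ∈ sN, ∫⁻ y in c Q, φ y ∂μ := by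
          rw [lintegral_finsetSum _ fun Q _ => hgm Q]
          refine Finset.sum_congr rfl fun Q _ => ?_
          rw [lintegral_indicator_const (star Q).measurableSet]
          refine ENNReal.div_mul_cancel ?_ ((star Q).measure_ne_top hX)
          exact ((star Q).measure_pos hX).ne'
      _ = ∑ P ∈ u, ∑ Q ∈ t P, ∫⁻ y in c Q, φ y ∂μ := by
          refine Finset.sum_biUnion fun P hP R hR hne => ?_
          refine Finset.disjoint_left.2 fun Q hQ hQ' => ?_
          have h1 := (Finset.mem_filter.1 hQ).2.1
          have h2 := (Finset.mem_filter.1 hQ').2.1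
          have hQc : S.center (Q : S.Cube).level (c Q) ∈ c Q := (Q : S.Cube).center_mem hX
          exact Set.disjoint_left.1 (hud hP hR hne) (h1 hQc) (h2 hQc)
      _ ≤ ∑ P ∈ u, (L * k : ℕ) * ∫⁻ y in c P, φ y ∂μ :=
          Finset.sum_le_sum fun P _ => hF.sum_nonlocal_le hX hS' hL P.2 (t P)
            (fun Q hQ => (Finset.mem_filter.1 hQ).2) φ
      _ ≤ _ := by
          rw [← Finset.mul_sum]
          gcongr
  calc _ ≤ a * (μ {x | (a : ℝ≥0∞) < ∑ Q ∈ s₂, g Q x} + μ Ω +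
        μ {x | (a : ℝ≥0∞) ≤ ∑ Q ∈ sN, g Q x}) := by
        gcongr
        exact (measure_mono hsub).trans ((measure_union_le _ _).trans
          (add_le_add (measure_union_le _ _) le_rfl))
    _ ≤ 16 * (∫⁻ x, φ x ∂μ) + ENNReal.ofReal Cd ^ n * (∫⁻ x, φ x ∂μ) +
        (L * k : ℕ) * ∫⁻ x, φ x ∂μ := by
        rw [mul_add, mul_add]
        exact add_le_add (add_le_add hs₂ hΩ) hsN
    _ = _ := by ring

/-- The weak type estimate for the full sum. -/
theorem mul_measure_lt_tsum_le (hX : IsHomogeneousSpace ρ μ C₀ Cd) (hD : 0 < D)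
    (hF : IsSparseFamily S Q₀ F) (hS' : S' ⊆ ⋃ n, F n) (hstar : IsStarMap D k S' star)
    {n : ℕ} (hn : C₀ * (C * (1 + D)) ≤ 2 ^ n) {L : ℕ} (hL : δ ^ L ≤ 1 / 2)
    (φ : X → ℝ≥0∞) (a : ℝ≥0) (ha : 0 < a) :
    a * μ {x | 2 * (a : ℝ≥0∞) < ∑' Q : S', (star Q).carrier.indicator
      (fun _ => (∫⁻ y in (Q : S.Cube).carrier, φ y ∂μ) / μ (star Q).carrier) x} ≤
      (16 + ENNReal.ofReal Cd ^ n + (L * k : ℕ)) * ∫⁻ x, φ x ∂μ := by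
  have : Countable S' :=
    Set.Countable.mono hS' (Set.countable_iUnion fun n => hF.countable hX n)
  simp_rw [ENNReal.tsum_eq_iSup_sum, lt_iSup_iff, Set.ofPred_exists]
  rw [Directed.measure_iUnion, ENNReal.mul_iSup]
  · exact iSup_le fun s => hF.mul_measure_lt_finset_sum_le hX hD hS' hstar hn hL s φ a ha
  · refine Monotone.directed_le fun s t hst x hx => ?_
    simp only [Set.mem_ofPred_eq] at hx ⊢
    exact lt_of_lt_of_le hx (Finset.sum_le_sum_of_subset hst)

end IsSparseFamily

/-! ### Signed functions and the main theorem -/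

theorem enorm_discreteAdjointTerm_le {X : Type*} [MeasurableSpace X] {ρ : X → X → ℝ}
    {μ : Measure X} {C₀ Cd C δ ε C' δ' ε' : ℝ} {S : DyadicDecomposition ρ μ C δ ε}
    {T : DyadicDecomposition ρ μ C' δ' ε'} {S' : Set S.Cube} {star : S' → T.Cube}
    (hX : IsHomogeneousSpace ρ μ C₀ Cd) (f : X → ℝ) (Q : S') (x : X) :
    ‖discreteAdjointTerm star f Q x‖ₑ ≤ (star Q).carrier.indicator
      (fun _ => (∫⁻ y in (Q : S.Cube).carrier, ‖f y‖ₑ ∂μ) / μ (star Q).carrier) x := by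
  rw [discreteAdjointTerm, enorm_indicator_eq_indicator_enorm]
  refine Set.indicator_le_indicator ?_
  have hR : ‖1 / μ.real (star Q).carrier‖ₑ = (μ (star Q).carrier)⁻¹ := by
    have hpos : 0 < μ.real (star Q).carrier :=
      ENNReal.toReal_pos ((star Q).measure_pos hX).ne' ((star Q).measure_ne_top hX)
    rw [one_div, Real.enorm_eq_ofReal (inv_pos.2 hpos).le, ENNReal.ofReal_inv_of_pos hpos,
      Measure.real, ENNReal.ofReal_toReal ((star Q).measure_ne_top hX)]
  rw [enorm_mul, hR, mul_comm, ENNReal.div_eq_inv_mul, mul_comm]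
  gcongr
  exact enorm_integral_le_lintegral_enorm _

theorem mainTheorem4 {X : Type*} [MeasurableSpace X] (ρ : X → X → ℝ) (μ : Measure X)
    (C₀ Cd : ℝ) (hX : IsHomogeneousSpace ρ μ C₀ Cd)
    (C δ ε D : ℝ) (hD : 0 < D) :
    ∃ β : ℝ≥0, ∀ (C' δ' ε' : ℝ) (S : DyadicDecomposition ρ μ C δ ε)
      (T : DyadicDecomposition ρ μ C' δ' ε') (Q₀ : S.Cube) (F : ℕ → Set S.Cube),
      IsSparseFamily S Q₀ F →
      ∀ (k : ℕ), 1 ≤ k →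
      ∀ (S' : Set S.Cube), S' ⊆ ⋃ n, F n →
      ∀ (star : S' → T.Cube), IsStarMap D k S' star →
      ∀ f : X → ℝ, Integrable f μ →
        (∀ᵐ x ∂μ, Summable fun Q : S' => discreteAdjointTerm star f Q x) ∧
        weakL1Norm μ (discreteAdjoint star f) ≤ β * k * eLpNorm f 1 μ := by
  obtain ⟨n, hn⟩ := pow_unbounded_of_one_lt (C₀ * (C * (1 + D))) (one_lt_two (α := ℝ))
  -- `β` is fixed before any `S` supplies `0 < δ < 1`, hence the implications.
  obtain ⟨L, hL⟩ : ∃ L : ℕ, 0 < δ → δ < 1 → δ ^ L ≤ 1 / 2 := by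
    by_cases h : 0 < δ ∧ δ < 1
    · obtain ⟨L, hL⟩ := exists_pow_lt_of_lt_one (one_half_pos (α := ℝ)) h.2
      exact ⟨L, fun _ _ => hL.le⟩
    · exact ⟨0, fun h0 h1 => absurd ⟨h0, h1⟩ h⟩
  -- The factor 2 comes from using the estimate at height `a / 2`; `k ≥ 1` absorbs the terms free of
  -- `k`.
  refine ⟨2 * (16 + Cd.toNNReal ^ n + L),
    fun C' δ' ε' S T Q₀ F hF k hk S' hS' star hstar f hf => ?_⟩
  set K : ℝ≥0∞ := 16 + ENNReal.ofReal Cd ^ n + (L * k : ℕ) with hK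
  set I : ℝ≥0∞ := ∫⁻ x, ‖f x‖ₑ ∂μ with hI
  have hIfin : I ≠ ∞ := hf.2.ne
  have hKfin : K ≠ ∞ := ENNReal.add_ne_top.2
    ⟨ENNReal.add_ne_top.2 ⟨by simp, by simp⟩, ENNReal.natCast_ne_top _⟩
  let B : X → ℝ≥0∞ := fun x => ∑' Q : S', (star Q).carrier.indicator
      (fun _ => (∫⁻ y in (Q : S.Cube).carrier, ‖f y‖ₑ ∂μ) / μ (star Q).carrier) x
  have hweak : ∀ a : ℝ≥0, 0 < a → a * μ {x | 2 * (a : ℝ≥0∞) < B x} ≤ K * I := fun a ha =>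
    hF.mul_measure_lt_tsum_le hX hD hS' hstar hn.le (hL S.δ_pos S.δ_lt_one) _ a ha
  have hfB : ∀ x, ∑' Q : S', ‖discreteAdjointTerm star f Q x‖ₑ ≤ B x := fun x =>
    ENNReal.tsum_le_tsum fun Q => enorm_discreteAdjointTerm_le hX f Q x
  -- The set where `B = ∞` lies in every superlevel set, and `a` is arbitrarily large.
  have hBfin : ∀ᵐ x ∂μ, B x ≠ ∞ := by
    rw [ae_iff]
    by_contra h0
    have htop : μ {x | ¬ B x ≠ ∞} ≠ 0 := h0
    have hle : ∀ a : ℝ≥0, 0 < a → a * μ {x | ¬ B x ≠ ∞} ≤ K * I := fun a ha => by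
      refine le_trans ?_ (hweak a ha)
      gcongr with x
      intro hx
      rw [not_ne_iff.1 hx]
      exact (ENNReal.mul_ne_top (by simp) ENNReal.coe_ne_top).lt_top
    obtain ⟨N, hN⟩ := ENNReal.exists_nat_mul_gt htop (ENNReal.mul_ne_top hKfin hIfin)
    have hNpos : 0 < N := by
      rcases Nat.eq_zero_or_pos N with rfl | h
      · simp at hN
      · exact h
    exact absurd hN (not_lt.2 (by exact_mod_cast hle N (by exact_mod_cast hNpos)))
  refine ⟨hBfin.mono fun x hx => ?_, iSup_le fun a => ?_⟩
  · refine Summable.of_nnnorm (ENNReal.tsum_coe_ne_top_iff_summable.1 ?_)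
    exact ne_top_of_le_ne_top hx (hfB x)
  · rcases eq_or_lt_of_le (zero_le (a := a)) with rfl | ha
    · simp
    have h2 : (a : ℝ≥0∞) = 2 * ((a / 2 : ℝ≥0) : ℝ≥0∞) := by
      rw [← ENNReal.coe_ofNat, ← ENNReal.coe_mul, mul_div_cancel₀ _ (two_ne_zero)]
    have hsub : {x | (a : ℝ) < |discreteAdjoint star f x|} ⊆
        {x | 2 * ((a / 2 : ℝ≥0) : ℝ≥0∞) < B x} := fun x hx => by
      rw [Set.mem_ofPred_eq, ← h2]
      refine lt_of_lt_of_le ?_ (enorm_tsum_le_tsum_enorm.trans (hfB x))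
      change (a : ℝ≥0∞) < (‖discreteAdjoint star f x‖₊ : ℝ≥0∞)
      exact_mod_cast (show (a : ℝ) < ‖discreteAdjoint star f x‖ from hx)
    have hKk : K ≤ (16 + ENNReal.ofReal Cd ^ n + L) * k := by
      have hk' : (1 : ℝ≥0∞) ≤ k := by exact_mod_cast hk
      calc K = (16 + ENNReal.ofReal Cd ^ n) * 1 + L * k := by rw [hK]; push_cast; ring
        _ ≤ (16 + ENNReal.ofReal Cd ^ n) * k + L * k := by gcongr
        _ = _ := by ring
    rw [eLpNorm_one_eq_lintegral_enorm]
    calc (a : ℝ≥0∞) * μ {x | (a : ℝ) < |discreteAdjoint star f x|}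
        ≤ a * μ {x | 2 * ((a / 2 : ℝ≥0) : ℝ≥0∞) < B x} := by gcongr
      _ = 2 * (((a / 2 : ℝ≥0) : ℝ≥0∞) * μ {x | 2 * ((a / 2 : ℝ≥0) : ℝ≥0∞) < B x}) := by
          rw [← mul_assoc, ← h2]
      _ ≤ 2 * (K * I) := mul_le_mul_right (hweak _ (half_pos ha)) _
      _ ≤ 2 * ((16 + ENNReal.ofReal Cd ^ n + L) * k * I) := by gcongr
      _ = _ := by
          push_cast
          rw [ENNReal.ofReal]
          ring
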